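/- **Symplectic covariance of the generating function $\Gamma^\hbar$.** Let $d\in\mathbb N$ and $\hbar>0$. Write a real symplectic matrix $S=\begin{bmatrix}A&B\\C&D\end{bmatrix}\in\mathsf{Sp}(2d,\mathbb R)$ as $S=\begin{bmatrix}\operatorname{Re}Q&\operatorname{Im}Q\\ \operatorname{Re}P&\operatorname{Im}P\end{bmatrix}$ with $Q=A+\mathrm iB$ and $P=C+\mathrm iD$; then $Q$ is invertible. For $w\in\mathbb C^d$ and $x\in\mathbb R^d$ put $$\Gamma^\hbar(S;w,x)=\frac{(\det Q)^{-1/2}}{(\pi\hbar)^{d/4}}\exp\Bigl(\frac{\mathrm i}{2\hbar}x^TPQ^{-1}x+\frac{2}{\sqrt\hbar}\,w^TQ^{-1}x-w^TQ^{-1}\overline Q\,w\Bigr),$$ where $(\det Q)^{-1/2}$ is either of the two complex numbers whose square is $1/\det Q$; thus $\Gamma^\hbar(S;\cdot,\cdot)$ is defined up to a sign. The metaplectic group $\mathsf{Mp}(2d,\mathbb R)$ is the group of unitary operators on $L^2(\mathbb R^d)$ generated by - $\widehat J$, the unitary extension of $\widehat J\psi(x)=(2\pi\hbar\,\mathrm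 i)^{-d/2}\int_{\mathbb R^d}e^{-\frac{\mathrm i}{\hbar}x\cdot\tilde x}\psi(\tilde x)\,d\tilde x$ from the Schwartz space (principal value of the power); - $\widehat V_R\psi(x)=e^{\frac{\mathrm i}{2\hbar}x^TRx}\psi(x)$, for real symmetric $d\times d$ matrices $R$; - $\widehat M_L^m\psi(x)=\mathrm i^m\sqrt{|\det L|}\,\psi(Lx)$, for $L\in\mathsf{GL}(d,\mathbb R)$ and every $m\in\mathbb Z$ with $m\pi\equiv\arg(\det L)\pmod{2\pi}$, and $\pi_{\mathsf{Mp}}\colon\mathsf{Mp}(2d,\mathbb R)\to\mathsf{Sp}(2d,\mathbb R)$ is the group homomorphism with $$\widehat J\mapsto\begin{bmatrix}0&I\\-I&0\end{bmatrix},\qquad \widehat V_R\mapsto\begin{bmatrix}I&0\\R&I\end{bmatrix},\qquad \widehat M_L^m\mapsto\begin{bmatrix}L^{-1}&0\\0&L^T\end{bmatrix}.$$ Let $S_0\in\mathsf{Sp}(2d,\mathbb R)$ and $\widehat S\in\mathsf{Mp}(2d,\mathbb R)$, with $S=\pi_{\mathsf{Mp}}(\widehat S)$. Then for every $w\in\mathbb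 C^d$ the function $\Gamma^\hbar(S_0;w,\cdot)$ belongs to $L^2(\mathbb R^d)$, and $$\widehat S\,\Gamma^\hbar(S_0;w,\cdot)=\Gamma^\hbar(SS_0;w,\cdot)\quad\text{in }L^2(\mathbb R^d).$$ Precisely: for each choice of the square root in $\Gamma^\hbar(S_0;\cdot,\cdot)$ there is a choice of the square root in $\Gamma^\hbar(SS_0;\cdot,\cdot)$, independent of $w$, for which this identity holds for all $w\in\mathbb C^d$. -/

import Mathlib

open MeasureTheory
open scoped Matrix

noncomputable section

namespace Metaplectic

/-- The configuration space `ℝᵈ` with its Euclidean structure and Lebesgue measure. -/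
abbrev Config (d : ℕ) : Type := EuclideanSpace ℝ (Fin d)

/-- The Hilbert space `L²(ℝᵈ)` of complex-valued functions. -/
abbrev L2 (d : ℕ) : Type := Lp ℂ 2 (volume : Measure (Config d))

/-- The group `U(L²(ℝᵈ))` of unitary operators. -/
abbrev UnitaryOps (d : ℕ) : Type := L2 d ≃ₗᵢ[ℂ] L2 d

/-- The real symplectic group `Sp(2d, ℝ)`. -/
abbrev Sp (d : ℕ) : Type := Matrix.symplecticGroup (Fin d) ℝ

/-! ### Weighted substitution operators `ψ ↦ c(x) ψ(A x)` -/

namespace WeightedSubst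

variable {d : ℕ}

theorem map_volume (A : Config d ≃L[ℝ] Config d) :
    (volume : Measure (Config d)).map A
      = ENNReal.ofReal |(LinearMap.det (A : Config d →ₗ[ℝ] Config d))⁻¹| • volume := by
  have h : LinearMap.det (A : Config d →ₗ[ℝ] Config d) ≠ 0 :=
    (LinearEquiv.isUnit_det' A.toLinearEquiv).ne_zero
  exact Measure.map_linearMap_addHaar_eq_smul_addHaar (volume : Measure (Config d)) h

theorem aesm_comp (A : Config d ≃L[ℝ] Config d) {f : Config d → ℂ}
    (hf : AEStronglyMeasurable f (volume : Measure (Config d))) :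
    AEStronglyMeasurable f ((volume : Measure (Config d)).map A) := by
  rw [map_volume]
  exact hf.smul_measure _

theorem ae_comp (A : Config d ≃L[ℝ] Config d) {f g : Config d → ℂ}
    (h : f =ᵐ[volume] g) : (fun x => f (A x)) =ᵐ[volume] fun x => g (A x) := by
  have h' : f =ᵐ[(volume : Measure (Config d)).map A] g := by
    rw [map_volume]
    exact Measure.ae_smul_measure h _
  exact ae_of_ae_map A.continuous.aemeasurable h'

theorem eLpNorm_eq {c : Config d → ℂ} (A : Config d ≃L[ℝ] Config d)
    (hn : ∀ x, ‖c x‖ = √|LinearMap.det (A : Config d →ₗ[ℝ] Config d)|) {f : Config d → ℂ}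
    (hf : AEStronglyMeasurable f (volume : Measure (Config d))) :
    eLpNorm (fun x => c x * f (A x)) 2 volume = eLpNorm f 2 volume := by
  set D := LinearMap.det (A : Config d →ₗ[ℝ] Config d) with hD
  have hD0 : D ≠ 0 := (LinearEquiv.isUnit_det' A.toLinearEquiv).ne_zero
  have h1 : eLpNorm (fun x => c x * f (A x)) 2 volume
      = eLpNorm ((√|D| : ℝ) • (f ∘ A)) 2 volume := by
    refine eLpNorm_congr_norm_ae (Filter.Eventually.of_forall fun x => ?_)
    simp [hn x, abs_of_nonneg (Real.sqrt_nonneg _)]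
  rw [h1, eLpNorm_const_smul, ← eLpNorm_map_measure (aesm_comp A hf) A.continuous.aemeasurable,
    map_volume, eLpNorm_smul_measure_of_ne_top (by simp), ← hD, smul_eq_mul, ← mul_assoc]
  have h2 : ‖(√|D| : ℝ)‖ₑ * ENNReal.ofReal |D⁻¹| ^ (1 / (2 : ENNReal)).toReal = 1 := by
    have hpos : 0 < |D| := abs_pos.mpr hD0
    rw [Real.enorm_eq_ofReal (Real.sqrt_nonneg _),
      ENNReal.ofReal_rpow_of_nonneg (abs_nonneg _) (by simp),
      ← ENNReal.ofReal_mul (Real.sqrt_nonneg _)]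
    have : (1 / (2 : ENNReal)).toReal = 1 / 2 := by simp
    rw [this, ← Real.sqrt_eq_rpow, abs_inv, Real.sqrt_inv, mul_inv_cancel₀, ENNReal.ofReal_one]
    exact (Real.sqrt_pos.mpr hpos).ne'
  rw [h2, one_mul]

theorem memLp {c : Config d → ℂ} (hc : Continuous c) (A : Config d ≃L[ℝ] Config d)
    (hn : ∀ x, ‖c x‖ = √|LinearMap.det (A : Config d →ₗ[ℝ] Config d)|) {f : Config d → ℂ}
    (hf : MemLp f 2 (volume : Measure (Config d))) :
    MemLp (fun x => c x * f (A x)) 2 (volume : Measure (Config d)) := by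
  refine ⟨hc.aestronglyMeasurable.mul
    ((aesm_comp A hf.1).comp_aemeasurable A.continuous.aemeasurable), ?_⟩
  rw [eLpNorm_eq A hn hf.1]
  exact hf.2

/-- The operator `ψ ↦ c(x) ψ(A x)` as a linear isometry of `L²`, where `|c| = |det A|^{1/2}`. -/
def isometry (c : Config d → ℂ) (hc : Continuous c) (A : Config d ≃L[ℝ] Config d)
    (hn : ∀ x, ‖c x‖ = √|LinearMap.det (A : Config d →ₗ[ℝ] Config d)|) : L2 d →ₗᵢ[ℂ] L2 d where
  toFun f := (memLp hc A hn (Lp.memLp f)).toLp _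
  map_add' f g := by
    refine Lp.ext ?_
    refine (MemLp.coeFn_toLp _).trans (Filter.EventuallyEq.trans ?_ (Lp.coeFn_add _ _).symm)
    filter_upwards [ae_comp A (Lp.coeFn_add f g),
      MemLp.coeFn_toLp (memLp hc A hn (Lp.memLp f)),
      MemLp.coeFn_toLp (memLp hc A hn (Lp.memLp g))] with x h1 h2 h3
    rw [h1, Pi.add_apply, Pi.add_apply, h2, h3, mul_add]
  map_smul' a f := by
    refine Lp.ext ?_
    refine (MemLp.coeFn_toLp _).trans (Filter.EventuallyEq.trans ?_ (Lp.coeFn_smul _ _).symm)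
    filter_upwards [ae_comp A (Lp.coeFn_smul a f),
      MemLp.coeFn_toLp (memLp hc A hn (Lp.memLp f))] with x h1 h2
    rw [h1, Pi.smul_apply, Pi.smul_apply, RingHom.id_apply, h2, smul_eq_mul, smul_eq_mul]
    ring
  norm_map' f := by
    change ‖(memLp hc A hn (Lp.memLp f)).toLp _‖ = ‖f‖
    rw [Lp.norm_toLp, Lp.norm_def, eLpNorm_eq A hn (Lp.aestronglyMeasurable f)]

theorem isometry_coeFn (c : Config d → ℂ) (hc : Continuous c) (A : Config d ≃L[ℝ] Config d)
    (hn : ∀ x, ‖c x‖ = √|LinearMap.det (A : Config d →ₗ[ℝ] Config d)|) (f : L2 d) :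
    (isometry c hc A hn f : Config d → ℂ) =ᵐ[volume] fun x => c x * f (A x) :=
  MemLp.coeFn_toLp (memLp hc A hn (Lp.memLp f))

theorem isometry_surjective (c : Config d → ℂ) (hc : Continuous c) (A : Config d ≃L[ℝ] Config d)
    (hn : ∀ x, ‖c x‖ = √|LinearMap.det (A : Config d →ₗ[ℝ] Config d)|) :
    Function.Surjective (isometry c hc A hn) := by
  have hD0 : LinearMap.det (A : Config d →ₗ[ℝ] Config d) ≠ 0 :=
    (LinearEquiv.isUnit_det' A.toLinearEquiv).ne_zero
  have hdet : LinearMap.det (A.symm : Config d →ₗ[ℝ] Config d)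
      = (LinearMap.det (A : Config d →ₗ[ℝ] Config d))⁻¹ :=
    LinearEquiv.det_coe_symm A.toLinearEquiv
  have hc0 : ∀ x, c x ≠ 0 := fun x hx => by
    have := hn x
    rw [hx, norm_zero, eq_comm, Real.sqrt_eq_zero (abs_nonneg _), abs_eq_zero] at this
    exact hD0 this
  intro g
  have hc' : Continuous fun x => (c (A.symm x))⁻¹ :=
    (hc.comp A.symm.continuous).inv₀ fun x => hc0 _
  have hn' : ∀ x, ‖(c (A.symm x))⁻¹‖
      = √|LinearMap.det (A.symm : Config d →ₗ[ℝ] Config d)| := fun x => by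
    rw [norm_inv, hn, hdet, abs_inv, Real.sqrt_inv]
  refine ⟨isometry _ hc' A.symm hn' g, Lp.ext ?_⟩
  filter_upwards [isometry_coeFn c hc A hn (isometry _ hc' A.symm hn' g),
    ae_comp A (isometry_coeFn _ hc' A.symm hn' g)] with x h1 h2
  rw [h1, h2, A.symm_apply_apply, ← mul_assoc, mul_inv_cancel₀ (hc0 x), one_mul]

end WeightedSubst

/-- The unitary operator `(U ψ)(x) = c(x) ψ(A x)` on `L²(ℝᵈ)`, where `|c(x)| = |det A|^{1/2}`. -/
def weightedSubst {d : ℕ} (c : Config d → ℂ) (hc : Continuous c) (A : Config d ≃L[ℝ] Config d)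
    (hn : ∀ x, ‖c x‖ = √|LinearMap.det (A : Config d →ₗ[ℝ] Config d)|) : UnitaryOps d :=
  LinearIsometryEquiv.ofSurjective (WeightedSubst.isometry c hc A hn)
    (WeightedSubst.isometry_surjective c hc A hn)

theorem weightedSubst_coeFn {d : ℕ} (c : Config d → ℂ) (hc : Continuous c)
    (A : Config d ≃L[ℝ] Config d)
    (hn : ∀ x, ‖c x‖ = √|LinearMap.det (A : Config d →ₗ[ℝ] Config d)|) (f : L2 d) :
    (weightedSubst c hc A hn f : Config d → ℂ) =ᵐ[volume] fun x => c x * f (A x) :=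
  WeightedSubst.isometry_coeFn c hc A hn f

/-! ### The generators of the metaplectic group -/

/-- The quadratic form `xᵀ R x`. -/
def quadForm {d : ℕ} (R : Matrix (Fin d) (Fin d) ℝ) (x : Config d) : ℝ :=
  x.ofLp ⬝ᵥ (R *ᵥ x.ofLp)

theorem continuous_quadForm {d : ℕ} (R : Matrix (Fin d) (Fin d) ℝ) :
    Continuous (quadForm R) := by
  unfold quadForm Matrix.mulVec dotProduct
  fun_prop

/-- The operator `V̂_R`, i.e. `V̂_R ψ(x) = exp(i xᵀRx / (2ħ)) ψ(x)`. -/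
def VHat (d : ℕ) (hbar : ℝ) (R : Matrix (Fin d) (Fin d) ℝ) : UnitaryOps d :=
  weightedSubst (fun x => Complex.exp (((quadForm R x / (2 * hbar) : ℝ) : ℂ) * Complex.I))
    (by have := continuous_quadForm R; fun_prop)
    (ContinuousLinearEquiv.refl ℝ (Config d))
    (fun x => by
      rw [Complex.norm_exp_ofReal_mul_I]
      have : ((ContinuousLinearEquiv.refl ℝ (Config d) : Config d ≃L[ℝ] Config d) :
        Config d →ₗ[ℝ] Config d) = LinearMap.id := rfl
      rw [this, LinearMap.det_id, abs_one, Real.sqrt_one])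

theorem VHat_coeFn (d : ℕ) (hbar : ℝ) (R : Matrix (Fin d) (Fin d) ℝ) (ψ : L2 d) :
    (VHat d hbar R ψ : Config d → ℂ) =ᵐ[volume] fun x =>
      Complex.exp (((quadForm R x / (2 * hbar) : ℝ) : ℂ) * Complex.I) * ψ x :=
  weightedSubst_coeFn _ _ _ _ ψ

/-- The linear automorphism `x ↦ L x` of `ℝᵈ` given by an invertible matrix. -/
def glEquiv {d : ℕ} (L : GL (Fin d) ℝ) : Config d ≃L[ℝ] Config d :=
  ContinuousLinearEquiv.unitsEquiv ℝ (Config d)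
    (Units.map (Matrix.toEuclideanCLM (n := Fin d) (𝕜 := ℝ) : _ →* _) L)

theorem glEquiv_apply {d : ℕ} (L : GL (Fin d) ℝ) (x : Config d) :
    glEquiv L x = WithLp.toLp 2 ((L : Matrix (Fin d) (Fin d) ℝ) *ᵥ x.ofLp) := rfl

theorem det_glEquiv {d : ℕ} (L : GL (Fin d) ℝ) :
    LinearMap.det (glEquiv L : Config d →ₗ[ℝ] Config d)
      = (L : Matrix (Fin d) (Fin d) ℝ).det := by
  have h : (glEquiv L : Config d →ₗ[ℝ] Config d)
      = Matrix.toLin (EuclideanSpace.basisFun (Fin d) ℝ).toBasis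
          (EuclideanSpace.basisFun (Fin d) ℝ).toBasis (L : Matrix (Fin d) (Fin d) ℝ) := by
    rfl
  rw [h, LinearMap.det_toLin]

/-- The operator `M̂_L^m`, i.e. `M̂_L^m ψ(x) = i^m |det L|^{1/2} ψ(L x)`. -/
def MHat (d : ℕ) (L : GL (Fin d) ℝ) (m : ℤ) : UnitaryOps d :=
  weightedSubst (fun _ => Complex.I ^ m * (√|(L : Matrix (Fin d) (Fin d) ℝ).det| : ℝ))
    continuous_const (glEquiv L)
    (fun x => by
      rw [det_glEquiv, norm_mul, norm_zpow, Complex.norm_I, one_zpow, one_mul,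
        Complex.norm_real, Real.norm_of_nonneg (Real.sqrt_nonneg _)])

theorem MHat_coeFn (d : ℕ) (L : GL (Fin d) ℝ) (m : ℤ) (ψ : L2 d) :
    (MHat d L m ψ : Config d → ℂ) =ᵐ[volume] fun x =>
      Complex.I ^ m * (√|(L : Matrix (Fin d) (Fin d) ℝ).det| : ℝ)
        * ψ (WithLp.toLp 2 ((L : Matrix (Fin d) (Fin d) ℝ) *ᵥ x.ofLp)) :=
  weightedSubst_coeFn _ _ _ _ ψ

/-- `m` is an admissible index for `L`: `m π ≡ arg (det L) (mod 2π)`. -/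
def IsIndex {d : ℕ} (L : GL (Fin d) ℝ) (m : ℤ) : Prop :=
  ∃ k : ℤ, (m : ℝ) * Real.pi
    = Complex.arg (((L : Matrix (Fin d) (Fin d) ℝ).det : ℝ) : ℂ) + 2 * Real.pi * k

/-- The operator `ψ ↦ i^{-d/2} (2πħ)^{-d/2} ψ(x / (2πħ))`, with `i^{-d/2} = exp(-iπd/4)`. -/
def rescale (d : ℕ) (hbar : ℝ) (h : 0 < hbar) : UnitaryOps d :=
  weightedSubst
    (fun _ => Complex.exp (((-(Real.pi * d / 4) : ℝ) : ℂ) * Complex.I)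
      * (((2 * Real.pi * hbar) ^ (-(d : ℝ) / 2) : ℝ) : ℂ))
    continuous_const
    (ContinuousLinearEquiv.smulLeft
      (Units.mk0 ((2 * Real.pi * hbar)⁻¹) (by positivity)))
    (fun x => by
      have hp : 0 < 2 * Real.pi * hbar := by positivity
      have hA : ((ContinuousLinearEquiv.smulLeft
          (Units.mk0 ((2 * Real.pi * hbar)⁻¹) (inv_ne_zero hp.ne')) :
            Config d ≃L[ℝ] Config d) : Config d →ₗ[ℝ] Config d)
          = (2 * Real.pi * hbar)⁻¹ • LinearMap.id := rfl
      rw [hA, LinearMap.det_smul, LinearMap.det_id, mul_one, finrank_euclideanSpace_fin,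
        norm_mul, Complex.norm_exp_ofReal_mul_I, one_mul, Complex.norm_real,
        Real.norm_of_nonneg (by positivity), abs_of_pos (by positivity), Real.sqrt_eq_rpow,
        ← Real.rpow_natCast, ← Real.rpow_mul (by positivity), Real.inv_rpow hp.le,
        ← Real.rpow_neg hp.le]
      congr 1
      ring)

/-- The operator `Ĵ`, the unitary extension to `L²(ℝᵈ)` of
`Ĵ ψ(x) = (2πħi)^{-d/2} ∫ exp(-i x·y/ħ) ψ(y) dy`. It is the Fourier transform
`𝓕 ψ(ξ) = ∫ exp(-2πi ξ·y) ψ(y) dy` followed by a rescaling; see `JHat_coeFn`. -/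
def JHat (d : ℕ) (hbar : ℝ) (h : 0 < hbar) : UnitaryOps d :=
  rescale d hbar h * Lp.fourierTransformₗᵢ (Config d) ℂ

theorem JHat_coeFn (d : ℕ) (hbar : ℝ) (h : 0 < hbar) (ψ : SchwartzMap (Config d) ℂ) :
    (JHat d hbar h (ψ.toLp 2) : Config d → ℂ) =ᵐ[volume] fun x =>
      1 / (2 * Real.pi * hbar * Complex.I : ℂ) ^ ((d : ℂ) / 2)
        * ∫ y : Config d, Complex.exp (-(Complex.I / hbar) * (inner ℝ x y : ℝ)) * ψ y := by
  have hp : 0 < 2 * Real.pi * hbar := by positivity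
  have hconst : (1 / (2 * Real.pi * hbar * Complex.I : ℂ) ^ ((d : ℂ) / 2))
      = Complex.exp (((-(Real.pi * d / 4) : ℝ) : ℂ) * Complex.I)
        * (((2 * Real.pi * hbar) ^ (-(d : ℝ) / 2) : ℝ) : ℂ) := by
    have e1 : (2 * Real.pi * hbar * Complex.I : ℂ)
        = ((2 * Real.pi * hbar : ℝ) : ℂ) * Complex.I := by push_cast; ring
    have hp0 : ((2 * Real.pi * hbar : ℝ) : ℂ) ≠ 0 := by exact_mod_cast hp.ne'
    rw [e1, one_div, ← Complex.cpow_neg,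
      Complex.cpow_def_of_ne_zero (mul_ne_zero hp0 Complex.I_ne_zero),
      Complex.log_ofReal_mul hp Complex.I_ne_zero, Complex.log_I,
      Real.rpow_def_of_pos hp, Complex.ofReal_exp, ← Complex.exp_add]
    congr 1
    push_cast
    ring
  have h0 : JHat d hbar h (ψ.toLp 2)
      = rescale d hbar h ((FourierTransform.fourier ψ).toLp 2) := by
    rw [← SchwartzMap.toLp_fourier_eq]
    rfl
  rw [h0, hconst]
  have h1 := WeightedSubst.ae_comp (ContinuousLinearEquiv.smulLeft
      (Units.mk0 ((2 * Real.pi * hbar)⁻¹) (inv_ne_zero hp.ne')))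
    (SchwartzMap.coeFn_toLp (FourierTransform.fourier ψ) 2 (volume : Measure (Config d)))
  filter_upwards [weightedSubst_coeFn _ _ _ _ ((FourierTransform.fourier ψ).toLp 2), h1]
    with x hx hx1
  refine hx.trans ?_
  rw [hx1, SchwartzMap.fourier_coe, Real.fourier_eq']
  congr 1
  refine integral_congr_ae (Filter.Eventually.of_forall fun y => ?_)
  have hs : (ContinuousLinearEquiv.smulLeft
      (Units.mk0 ((2 * Real.pi * hbar)⁻¹) (inv_ne_zero hp.ne')) : Config d ≃L[ℝ] Config d) x
      = (2 * Real.pi * hbar)⁻¹ • x := rfl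
  have hb : (hbar : ℂ) ≠ 0 := by exact_mod_cast h.ne'
  have hpi : (Real.pi : ℂ) ≠ 0 := by exact_mod_cast Real.pi_ne_zero
  simp only [hs, inner_smul_right, real_inner_comm x y, smul_eq_mul]
  congr 2
  push_cast
  field_simp

/-! ### The metaplectic group and its projection to the symplectic group -/

/-- The metaplectic group `Mp(2d, ℝ)`: the subgroup of `U(L²(ℝᵈ))` generated by `Ĵ`, by `V̂_R`
for symmetric `R`, and by `M̂_L^m` for `L ∈ GL(d, ℝ)` and every admissible index `m`. -/
def metaplecticGroup (d : ℕ) (hbar : ℝ) (h : 0 < hbar) : Subgroup (UnitaryOps d) :=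
  Subgroup.closure
    ({JHat d hbar h}
      ∪ {U | ∃ R : Matrix (Fin d) (Fin d) ℝ, R.IsSymm ∧ U = VHat d hbar R}
      ∪ {U | ∃ (L : GL (Fin d) ℝ) (m : ℤ), IsIndex L m ∧ U = MHat d L m})

/-- The symplectic matrix `J`. -/
def symJ (d : ℕ) : Sp d :=
  ⟨Matrix.fromBlocks 0 1 (-1) 0, by simp [SymplecticGroup.fromBlocks_mem_iff]⟩

/-- The symplectic matrix `V_R`. -/
def symV {d : ℕ} (R : Matrix (Fin d) (Fin d) ℝ) (hR : R.IsSymm) : Sp d :=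
  ⟨Matrix.fromBlocks 1 0 R 1, by simp [SymplecticGroup.fromBlocks_mem_iff, hR.eq]⟩

/-- The symplectic matrix `M_L`. -/
def symM {d : ℕ} (L : GL (Fin d) ℝ) : Sp d :=
  ⟨Matrix.fromBlocks ((L⁻¹ : GL (Fin d) ℝ) : Matrix (Fin d) (Fin d) ℝ) 0 0
      (L : Matrix (Fin d) (Fin d) ℝ)ᵀ, by
    have h : (L : Matrix (Fin d) (Fin d) ℝ)
        * ((L⁻¹ : GL (Fin d) ℝ) : Matrix (Fin d) (Fin d) ℝ) = 1 := L.mul_inv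
    rw [SymplecticGroup.fromBlocks_mem_iff]
    refine ⟨by simp, by simp, ?_⟩
    rw [← Matrix.transpose_mul, h]
    simp⟩

/-- The graph of the projection `π_Mp : Mp(2d, ℝ) → Sp(2d, ℝ)`. Since `π_Mp` is the group
homomorphism with `Ĵ ↦ J`, `V̂_R ↦ V_R`, `M̂_L^m ↦ M_L`, its graph is the subgroup of
`U(L²(ℝᵈ)) × Sp(2d, ℝ)` generated by these pairs. -/
def projectionGraph (d : ℕ) (hbar : ℝ) (h : 0 < hbar) : Subgroup (UnitaryOps d × Sp d) :=
  Subgroup.closure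
    ({(JHat d hbar h, symJ d)}
      ∪ {p | ∃ (R : Matrix (Fin d) (Fin d) ℝ) (hR : R.IsSymm), p = (VHat d hbar R, symV R hR)}
      ∪ {p | ∃ (L : GL (Fin d) ℝ) (m : ℤ), IsIndex L m ∧ p = (MHat d L m, symM L)})

/-- `Shat` is a metaplectic operator with `π_Mp Shat = S`. -/
def IsMetaplecticOver {d : ℕ} {hbar : ℝ} (h : 0 < hbar) (Shat : UnitaryOps d) (S : Sp d) : Prop :=
  (Shat, S) ∈ projectionGraph d hbar h

/-- The metaplectic operators are exactly the operators that lie over some symplectic matrix. -/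
theorem mem_metaplecticGroup_iff {d : ℕ} {hbar : ℝ} (h : 0 < hbar) (Shat : UnitaryOps d) :
    Shat ∈ metaplecticGroup d hbar h ↔ ∃ S : Sp d, IsMetaplecticOver h Shat S := by
  have hmap : metaplecticGroup d hbar h
      = (projectionGraph d hbar h).map (MonoidHom.fst (UnitaryOps d) (Sp d)) := by
    rw [metaplecticGroup, projectionGraph, MonoidHom.map_closure]
    congr 1
    ext U
    constructor
    · rintro ((hU | ⟨R, hR, hU⟩) | ⟨L, m, hm, hU⟩)
      · exact ⟨_, Or.inl (Or.inl rfl), hU.symm⟩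
      · exact ⟨_, Or.inl (Or.inr ⟨R, hR, rfl⟩), hU.symm⟩
      · exact ⟨_, Or.inr ⟨L, m, hm, rfl⟩, hU.symm⟩
    · rintro ⟨p, (hp | ⟨R, hR, hp⟩) | ⟨L, m, hm, hp⟩, rfl⟩
      · exact Or.inl (Or.inl (by rw [Set.mem_singleton_iff.mp hp]; rfl))
      · exact Or.inl (Or.inr ⟨R, hR, by rw [hp]; rfl⟩)
      · exact Or.inr ⟨L, m, hm, by rw [hp]; rfl⟩
  rw [hmap, Subgroup.mem_map]
  constructor
  · rintro ⟨p, hp, rfl⟩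
    exact ⟨p.2, hp⟩
  · rintro ⟨S, hS⟩
    exact ⟨(Shat, S), hS, rfl⟩

/-! ### The generating function -/

/-- `Q = A + iB` for `S = [A B; C D]`, i.e. `Re Q = A`, `Im Q = B`. -/
def Q {d : ℕ} (S : Sp d) : Matrix (Fin d) (Fin d) ℂ :=
  S.1.toBlocks₁₁.map Complex.ofReal + Complex.I • S.1.toBlocks₁₂.map Complex.ofReal

/-- `P = C + iD` for `S = [A B; C D]`, i.e. `Re P = C`, `Im P = D`. -/
def P {d : ℕ} (S : Sp d) : Matrix (Fin d) (Fin d) ℂ :=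
  S.1.toBlocks₂₁.map Complex.ofReal + Complex.I • S.1.toBlocks₂₂.map Complex.ofReal

/-- `μ` is one of the two values of `μ(S, i I) = (det Q)^{-1/2}`. -/
def IsMu {d : ℕ} (S : Sp d) (μ : ℂ) : Prop :=
  μ ^ 2 * (Q S).det = 1

/-- The generating function `Γ^ħ(S; w, x)`, with the value `μ` chosen for `(det Q)^{-1/2}`:
`μ (πħ)^{-d/4} exp(i/(2ħ) xᵀ P Q⁻¹ x + (2/√ħ) wᵀ Q⁻¹ x - wᵀ Q⁻¹ Q̄ w)`. -/
def Gamma {d : ℕ} (hbar : ℝ) (S : Sp d) (μ : ℂ) (w : Fin d → ℂ) (x : Config d) : ℂ :=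
  μ / (((Real.pi * hbar) ^ ((d : ℝ) / 4) : ℝ) : ℂ) *
    Complex.exp
      (Complex.I / (2 * (hbar : ℂ))
          * ((fun j => (x j : ℂ)) ⬝ᵥ ((P S * (Q S)⁻¹) *ᵥ fun j => (x j : ℂ)))
        + 2 / ((√hbar : ℝ) : ℂ) * (w ⬝ᵥ ((Q S)⁻¹ *ᵥ fun j => (x j : ℂ)))
        - w ⬝ᵥ (((Q S)⁻¹ * (Q S).map (starRingEnd ℂ)) *ᵥ w))

open scoped ComplexOrder in
/-- `Q` is invertible for every symplectic matrix. -/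
theorem det_Q_ne_zero {d : ℕ} (S : Sp d) : (Q S).det ≠ 0 := by
  intro h0
  obtain ⟨v, hv0, hv⟩ := Matrix.exists_mulVec_eq_zero_iff.mpr h0
  have hS := S.2
  rw [← Matrix.fromBlocks_toBlocks S.1, SymplecticGroup.fromBlocks_mem_iff] at hS
  obtain ⟨h1, h2, h3⟩ := hS
  have h4 := congrArg Matrix.transpose h3
  simp only [Matrix.transpose_sub, Matrix.transpose_mul, Matrix.transpose_transpose,
    Matrix.transpose_one] at h4
  have key : (Q S)ᴴ * P S - (P S)ᴴ * Q S = (2 * Complex.I) • (1 : Matrix (Fin d) (Fin d) ℂ) := by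
    ext i j
    have g1 := congrArg (fun M : Matrix (Fin d) (Fin d) ℝ => ((M i j : ℝ) : ℂ)) h1
    have g2 := congrArg (fun M : Matrix (Fin d) (Fin d) ℝ => ((M i j : ℝ) : ℂ)) h2
    have g3 := congrArg (fun M : Matrix (Fin d) (Fin d) ℝ => ((M i j : ℝ) : ℂ)) h3
    have g4 := congrArg (fun M : Matrix (Fin d) (Fin d) ℝ => ((M i j : ℝ) : ℂ)) h4
    simp only [Matrix.sub_apply, Matrix.mul_apply, Matrix.transpose_apply, Complex.ofReal_sub,
      Complex.ofReal_sum, Complex.ofReal_mul, Matrix.one_apply] at g1 g2 g3 g4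
    simp only [Q, P, Matrix.sub_apply, Matrix.mul_apply, Matrix.conjTranspose_apply,
      Matrix.add_apply, Matrix.smul_apply, Matrix.map_apply, smul_eq_mul, star_add, star_mul',
      Complex.star_def, Complex.conj_I, Complex.conj_ofReal, Matrix.one_apply]
    have e : ∀ a b c e : Fin d → ℂ, ∑ x, (a x + -Complex.I * b x) * (c x + Complex.I * e x)
        = (∑ x, a x * c x) + (∑ x, b x * e x)
          + Complex.I * ((∑ x, a x * e x) - ∑ x, b x * c x) := by
      intro a b c e
      rw [← Finset.sum_sub_distrib, Finset.mul_sum, ← Finset.sum_add_distrib,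
        ← Finset.sum_add_distrib]
      refine Finset.sum_congr rfl fun x _ => ?_
      linear_combination (-(b x * e x)) * Complex.I_sq
    rw [e, e]
    have hone : (((if i = j then 1 else 0 : ℝ)) : ℂ) = if i = j then 1 else 0 := by
      split_ifs <;> simp
    rw [hone] at g3 g4
    linear_combination g1 + g2 + Complex.I * g3 + Complex.I * g4
  have hz := congrArg (fun M : Matrix (Fin d) (Fin d) ℂ => star v ⬝ᵥ (M *ᵥ v)) key
  have ha : star v ⬝ᵥ (((Q S)ᴴ * P S) *ᵥ v) = 0 := by
    rw [← Matrix.mulVec_mulVec, Matrix.dotProduct_mulVec, ← Matrix.star_mulVec, hv]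
    simp
  have hb : star v ⬝ᵥ (((P S)ᴴ * Q S) *ᵥ v) = 0 := by
    rw [← Matrix.mulVec_mulVec, hv]
    simp
  simp only [Matrix.sub_mulVec, dotProduct_sub, ha, hb, Matrix.smul_mulVec, Matrix.one_mulVec,
    dotProduct_smul, sub_zero, smul_eq_mul] at hz
  have hne : (2 * Complex.I) ≠ 0 := mul_ne_zero two_ne_zero Complex.I_ne_zero
  have hvv : star v ⬝ᵥ v = 0 := by
    rcases mul_eq_zero.mp hz.symm with h | h
    · exact absurd h hne
    · exact h
  exact hv0 (dotProduct_star_self_eq_zero.mp hvv)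

/-- Hence `(det Q)^{-1/2}` has a value. -/
theorem exists_isMu {d : ℕ} (S : Sp d) : ∃ μ : ℂ, IsMu S μ := by
  obtain ⟨μ, hμ⟩ := IsAlgClosed.exists_pow_nat_eq ((Q S).det)⁻¹ (n := 2) (by norm_num)
  exact ⟨μ, by rw [IsMu, hμ, inv_mul_cancel₀ (det_Q_ne_zero S)]⟩

end Metaplectic

end

open Metaplectic

/-! The property "`U` sends each Γ(S₀; w, ·) to Γ(S S₀; w, ·), with a root independent of `w`"
(`IsCovariant`) is stable under products and inverses of pairs (U, S), so it need only be checked on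
the three kinds of generators.

As a function of x, Γ(S; w, ·) is a constant times exp(-½ xᵀMx + b·x), with M = -(i/ħ) P Q⁻¹ and b
linear in `w` (`Gamma_eq`). The symplectic relations make P Q⁻¹ symmetric and give Im(P Q⁻¹) = Q⁻ᵀ
Q̄⁻¹, a positive definite matrix (`posDef_im_P_mul_Q_inv`); hence Γ lies in L¹ ∩ L². Passing from S₀
to S S₀ multiplies the stacked pair (Q; P) by S on the left.

For V̂_R this adds R to P Q⁻¹ and fixes Q. For M̂_L it is the substitution x ↦ Lx, and the prefactor
squares to det L. For Ĵ the Gaussian integral replaces M by M⁻¹ = iħ Q P⁻¹, which is the quadratic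
part belonging to (P; -Q); the term quadratic in `w` is corrected by P̄ = P Q⁻¹ Q̄ - 2i Q⁻ᵀ
(`conj_P_eq`, `gaussianVector_sub_exponent`). Since the root is fixed only up to sign, each
prefactor is needed only through its square, and no branch has to be followed. -/

namespace Metaplectic

/-! ### The L² Fourier transform and complex Gaussian integrals -/

/-- On `L¹ ∩ L²` the `L²` Fourier transform is given by the Fourier integral. -/
theorem fourierTransform_toLp {d : ℕ} {f : Config d → ℂ} (hf1 : Integrable f)
    (hf2 : MemLp f 2) (hg : MemLp (FourierTransform.fourier f : Config d → ℂ) 2) :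
    Lp.fourierTransformₗᵢ (Config d) ℂ (hf2.toLp f) = hg.toLp _ := by
  -- L² embeds in the tempered distributions, where the Fourier transform is defined by duality; the
  -- claim becomes ∫ ĝ f = ∫ g f̂ for Schwartz g, which is Fubini for integrable f.
  have hinj : Function.Injective (Lp.toTemperedDistributionCLM (E := Config d) ℂ volume 2) :=
    LinearMap.ker_eq_bot.mp Lp.ker_toTemperedDistributionCLM_eq_bot
  apply hinj
  have h := Lp.fourier_toTemperedDistribution_eq (hf2.toLp f)
  refine Eq.trans h.symm ?_
  ext g
  rw [TemperedDistribution.fourier_apply, Lp.toTemperedDistribution_apply,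
    Lp.toTemperedDistributionCLM_apply, Lp.toTemperedDistribution_apply]
  have h1 : ∫ x, (FourierTransform.fourier g : SchwartzMap (Config d) ℂ) x • (hf2.toLp f) x
      = ∫ x, (FourierTransform.fourier (g : Config d → ℂ)) x • f x := by
    refine integral_congr_ae ?_
    filter_upwards [hf2.coeFn_toLp] with x hx
    rw [hx, SchwartzMap.fourier_coe]
  have h2 : ∫ x, g x • (hg.toLp _) x = ∫ x, g x • (FourierTransform.fourier f : Config d → ℂ) x := by
    refine integral_congr_ae ?_
    filter_upwards [hg.coeFn_toLp] with x hx
    rw [hx]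
  rw [h1, h2]
  simpa using! VectorFourier.integral_fourierIntegral_smul_eq_flip (L := innerₗ (Config d))
    Real.continuous_fourierChar continuous_inner (SchwartzMap.integrable g) hf1

/-- A real positive definite and a real symmetric matrix are simultaneously diagonalizable
by a congruence. -/
theorem exists_simultaneous_diagonalization {d : ℕ} {X Y : Matrix (Fin d) (Fin d) ℝ}
    (hX : X.PosDef) (hY : Y.IsSymm) :
    ∃ (T : Matrix (Fin d) (Fin d) ℝ) (l : Fin d → ℝ), T.det ≠ 0 ∧
      Tᵀ * X * T = 1 ∧ Tᵀ * Y * T = Matrix.diagonal l := by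
  -- Rescaling an orthonormal eigenbasis of X by the inverse square roots of the eigenvalues turns X
  -- into the identity. An orthogonal diagonalization of the transformed Y then preserves that
  -- identity.
  obtain ⟨T, hT⟩ : ∃ T : Matrix (Fin d) (Fin d) ℝ, Tᵀ * X * T = 1 := by
    have hpos := hX.eigenvalues_pos
    set e := hX.1.eigenvalues
    set U : Matrix (Fin d) (Fin d) ℝ := (hX.1.eigenvectorUnitary).1 with hU
    have hUU : Uᵀ * U = 1 := by
      have := Unitary.coe_star_mul_self hX.1.eigenvectorUnitary
      simpa [Matrix.star_eq_conjTranspose] using this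
    have hsp : Uᵀ * X * U = Matrix.diagonal e := by
      have := hX.1.conjStarAlgAut_star_eigenvectorUnitary
      simpa [Unitary.conjStarAlgAut_apply, Matrix.star_eq_conjTranspose, Function.comp_def] using this
    refine ⟨U * Matrix.diagonal fun i => (√(e i))⁻¹, ?_⟩
    rw [Matrix.transpose_mul, Matrix.diagonal_transpose,
      show ∀ A B : Matrix (Fin d) (Fin d) ℝ, A * Uᵀ * X * (U * B) = A * (Uᵀ * X * U) * B by
        intros; simp only [Matrix.mul_assoc], hsp,
      Matrix.diagonal_mul_diagonal, Matrix.diagonal_mul_diagonal, ← Matrix.diagonal_one]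
    congr 1
    ext i
    have h1 := Real.mul_self_sqrt (hpos i).le
    have h2 : √(e i) ≠ 0 := (Real.sqrt_pos.mpr (hpos i)).ne'
    field_simp
    rw [pow_two, h1]
  have hZ : (Tᵀ * Y * T).IsHermitian := by
    simp [Matrix.IsHermitian, Matrix.mul_assoc, hY.eq]
  set V : Matrix (Fin d) (Fin d) ℝ := (hZ.eigenvectorUnitary).1 with hV
  have hVV : Vᵀ * V = 1 := by
    have := Unitary.coe_star_mul_self hZ.eigenvectorUnitary
    simpa [Matrix.star_eq_conjTranspose] using this
  have hsp : Vᵀ * (Tᵀ * Y * T) * V = Matrix.diagonal hZ.eigenvalues := by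
    have := hZ.conjStarAlgAut_star_eigenvectorUnitary
    simpa [Unitary.conjStarAlgAut_apply, Matrix.star_eq_conjTranspose, Function.comp_def] using this
  have key : (T * V)ᵀ * X * (T * V) = 1 := by
    rw [Matrix.transpose_mul, show Vᵀ * Tᵀ * X * (T * V) = Vᵀ * (Tᵀ * X * T) * V by
      simp only [Matrix.mul_assoc], hT, Matrix.mul_one, hVV]
  refine ⟨T * V, hZ.eigenvalues, fun h0 => ?_, key, ?_⟩
  · have := congrArg Matrix.det key
    rw [Matrix.det_mul, h0, mul_zero, Matrix.det_one] at this
    exact zero_ne_one this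
  · rw [← hsp, Matrix.transpose_mul]
    simp only [Matrix.mul_assoc]

theorem mulVec_dotProduct {d : ℕ} (B : Matrix (Fin d) (Fin d) ℂ) (u v : Fin d → ℂ) :
    (B *ᵥ u) ⬝ᵥ v = u ⬝ᵥ (Bᵀ *ᵥ v) := by
  rw [Matrix.dotProduct_mulVec, Matrix.vecMul_transpose]

/-- The coordinates of a point of `ℝᵈ` as a complex vector. -/
noncomputable def cvec {d : ℕ} (x : Config d) : Fin d → ℂ := fun j => (x j : ℂ)

/-- The Gaussian with complex quadratic part `M` and linear part `b`. -/
noncomputable def gaussian {d : ℕ} (M : Matrix (Fin d) (Fin d) ℂ) (b : Fin d → ℂ) (x : Config d) : ℂ :=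
  Complex.exp (-(1 / 2) * (cvec x ⬝ᵥ (M *ᵥ cvec x)) + b ⬝ᵥ cvec x)

theorem continuous_gaussian {d : ℕ} (M : Matrix (Fin d) (Fin d) ℂ) (b : Fin d → ℂ) :
    Continuous (gaussian M b) := by
  unfold gaussian cvec Matrix.mulVec dotProduct
  fun_prop

/-- The integral of a complex Gaussian; the constant does not depend on the linear part. -/
theorem exists_integral_gaussian {d : ℕ} {M : Matrix (Fin d) (Fin d) ℂ} (hM : M.IsSymm)
    (hre : (M.map Complex.re).PosDef) :
    ∃ c : ℂ, c ^ 2 * M.det = (2 * Real.pi) ^ d ∧ ∀ b : Fin d → ℂ,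
      Integrable (gaussian M b) ∧
      ∫ x, gaussian M b x = c * Complex.exp (1 / 2 * (b ⬝ᵥ (M⁻¹ *ᵥ b))) := by
  have hY : (M.map Complex.im).IsSymm := by
    ext i j
    simpa using congrArg Complex.im (congrFun (congrFun hM i) j)
  obtain ⟨T, l, hT0, hTX, hTY⟩ := exists_simultaneous_diagonalization hre hY
  set Tc : Matrix (Fin d) (Fin d) ℂ := T.map Complex.ofReal with hTc
  -- The congruence by T turns M = X + iY into 1 + i diag(l), so the integral splits into
  -- one-dimensional ones.
  set D : Fin d → ℂ := fun i => 1 + Complex.I * l i with hD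
  have hDre : ∀ i, 0 < (D i / 2).re := by
    intro i; simp [hD]
  have hD0 : ∀ i, D i ≠ 0 := by
    intro i h0
    have := hDre i
    simp [h0] at this
  have hdec : M = (M.map Complex.re).map Complex.ofReal
      + Complex.I • (M.map Complex.im).map Complex.ofReal := by
    ext i j
    simp [mul_comm Complex.I, Complex.re_add_im]
  have hTM : Tcᵀ * M * Tc = Matrix.diagonal D := by
    have hmap : ∀ A : Matrix (Fin d) (Fin d) ℝ, Tcᵀ * A.map Complex.ofReal * Tc
        = (Tᵀ * A * T).map Complex.ofReal := by
      intro A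
      have : ∀ A B : Matrix (Fin d) (Fin d) ℝ, (A * B).map Complex.ofReal
          = A.map Complex.ofReal * B.map Complex.ofReal := fun A B =>
        Matrix.map_mul (L := A) (M := B) (f := Complex.ofRealHom)
      rw [this, this, Matrix.transpose_map]
    rw [hdec, Matrix.mul_add, Matrix.add_mul, Matrix.mul_smul, Matrix.smul_mul, hmap, hmap, hTX,
      hTY]
    ext i j
    by_cases hij : i = j
    · subst hij; simp [hD]
    · simp [hij]
  have hTcdet : Tc.det = (T.det : ℂ) := by
    rw [hTc]
    exact (RingHom.map_det Complex.ofRealHom T).symm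
  have hTc0 : Tc.det ≠ 0 := by rw [hTcdet]; exact_mod_cast hT0
  have hdet : (T.det : ℂ) ^ 2 * M.det = ∏ i, D i := by
    have := congrArg Matrix.det hTM
    rw [Matrix.det_mul, Matrix.det_mul, Matrix.det_transpose, Matrix.det_diagonal, hTcdet] at this
    rw [← this]; ring
  have hMinv : M⁻¹ = Tc * Matrix.diagonal (fun i => (D i)⁻¹) * Tcᵀ := by
    have hu : IsUnit Tc.det := isUnit_iff_ne_zero.mpr hTc0
    have hut : IsUnit Tcᵀ.det := by rwa [Matrix.det_transpose]
    apply Matrix.inv_eq_left_inv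
    have e1 : Tcᵀ * M = Matrix.diagonal D * Tc⁻¹ := by
      rw [← hTM, Matrix.mul_nonsing_inv_cancel_right _ _ hu]
    rw [Matrix.mul_assoc, e1, Matrix.mul_assoc, ← Matrix.mul_assoc (Matrix.diagonal _),
      Matrix.diagonal_mul_diagonal]
    simp [hD0, Matrix.mul_nonsing_inv _ hu]
  -- |det T| is the Jacobian of x = Tv; each factor is the one-dimensional integral of exp(-(Dᵢ/2)
  -- v²), with the principal root.
  refine ⟨(|T.det| : ℝ) * ∏ i, (Real.pi / (D i / 2)) ^ (1 / 2 : ℂ), ?_, fun b => ?_⟩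
  · have e1 : (∏ i, (Real.pi / (D i / 2) : ℂ) ^ (1 / 2 : ℂ)) ^ 2 = (2 * Real.pi) ^ d / ∏ i, D i := by
      rw [← Finset.prod_pow]
      have : ∀ i, ((Real.pi / (D i / 2) : ℂ) ^ (1 / 2 : ℂ)) ^ 2 = 2 * Real.pi / D i := by
        intro i
        rw [← Complex.cpow_nat_mul]
        norm_num
        field_simp
      rw [Finset.prod_congr rfl fun i _ => this i, Finset.prod_div_distrib, Finset.prod_const,
        Finset.card_univ, Fintype.card_fin]
    have e2 : (((|T.det| : ℝ) : ℂ)) ^ 2 = (T.det : ℂ) ^ 2 := by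
      norm_cast
      exact sq_abs _
    rw [mul_pow, e1, e2, mul_assoc, mul_comm, mul_assoc, mul_comm M.det, hdet, div_mul_cancel₀]
    exact Finset.prod_ne_zero_iff.mpr fun i _ => hD0 i
  · have hpull : ∀ v : Fin d → ℝ, gaussian M b (WithLp.toLp 2 (T *ᵥ v))
        = Complex.exp (-∑ i, (D i / 2) * (v i : ℂ) ^ 2 + ∑ i, (Tcᵀ *ᵥ b) i * v i) := by
      intro v
      have ev : cvec (WithLp.toLp 2 (T *ᵥ v)) = Tc *ᵥ fun i => (v i : ℂ) := by
        ext i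
        simp [cvec, Matrix.mulVec, dotProduct, hTc]
      rw [gaussian, ev]
      congr 2
      · rw [mulVec_dotProduct, Matrix.mulVec_mulVec, Matrix.mulVec_mulVec, hTM, dotProduct, Finset.mul_sum, ← Finset.sum_neg_distrib]
        refine Finset.sum_congr rfl fun i _ => ?_
        rw [Matrix.mulVec_diagonal]
        ring
      · change _ = (Tcᵀ *ᵥ b) ⬝ᵥ _
        rw [mulVec_dotProduct, Matrix.transpose_transpose]
    have hcomp : ∀ v : Fin d → ℝ, glEquiv (Matrix.GeneralLinearGroup.mkOfDetNeZero T hT0)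
        (WithLp.toLp 2 v) = WithLp.toLp 2 (T *ᵥ v) := fun v => rfl
    set A := glEquiv (Matrix.GeneralLinearGroup.mkOfDetNeZero T hT0) with hA
    have hAdet : LinearMap.det (A : Config d →ₗ[ℝ] Config d) = T.det := det_glEquiv _
    have hAm : MeasurableEmbedding A := A.toHomeomorph.measurableEmbedding
    have hmp := PiLp.volume_preserving_toLp (Fin d)
    have hme := (MeasurableEquiv.toLp 2 (Fin d → ℝ)).measurableEmbedding
    have hvol : (volume : Measure (Config d))
        = ENNReal.ofReal |T.det| • (volume : Measure (Config d)).map A := by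
      rw [WeightedSubst.map_volume, hAdet, smul_smul, ← ENNReal.ofReal_mul (abs_nonneg _),
        ← abs_mul, mul_inv_cancel₀ hT0, abs_one, ENNReal.ofReal_one, one_smul]
    constructor
    · rw [hvol]
      refine Integrable.smul_measure ?_ ENNReal.ofReal_ne_top
      rw [hAm.integrable_map_iff, ← hmp.integrable_comp_emb hme]
      refine (GaussianFourier.integrable_cexp_neg_sum_mul_add hDre (Tcᵀ *ᵥ b)).congr
        (Filter.Eventually.of_forall fun v => ?_)
      exact ((congrArg (gaussian M b) (hcomp v)).trans (hpull v)).symm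
    · rw [hvol, integral_smul_measure, hAm.integral_map, ← hmp.integral_comp hme]
      have : ∀ v : Fin d → ℝ, gaussian M b (A (WithLp.toLp 2 v)) = _ :=
        fun v => (congrArg (gaussian M b) (hcomp v)).trans (hpull v)
      simp only [this]
      rw [GaussianFourier.integral_cexp_neg_sum_mul_add hDre, Finset.prod_mul_distrib,
        ← Complex.exp_sum, ENNReal.toReal_ofReal (abs_nonneg _), Complex.real_smul, mul_assoc]
      congr 3
      rw [hMinv, Matrix.mul_assoc, ← Matrix.mulVec_mulVec, ← Matrix.mulVec_mulVec,
        dotProduct_comm, mulVec_dotProduct, dotProduct, Finset.mul_sum]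
      refine Finset.sum_congr rfl fun i _ => ?_
      rw [Matrix.mulVec_diagonal]
      have := hD0 i
      field_simp
      ring

/-! ### Left multiplication on the pair (Q; P) -/

theorem map_ofReal_mul {d : ℕ} (A B : Matrix (Fin d) (Fin d) ℝ) :
    (A * B).map Complex.ofReal = A.map Complex.ofReal * B.map Complex.ofReal :=
  Matrix.map_mul (L := A) (M := B) (f := Complex.ofRealHom)

theorem toBlocks_mul {d : ℕ} (T S : Sp d) :
    (T * S).1 = Matrix.fromBlocks
      (T.1.toBlocks₁₁ * S.1.toBlocks₁₁ + T.1.toBlocks₁₂ * S.1.toBlocks₂₁)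
      (T.1.toBlocks₁₁ * S.1.toBlocks₁₂ + T.1.toBlocks₁₂ * S.1.toBlocks₂₂)
      (T.1.toBlocks₂₁ * S.1.toBlocks₁₁ + T.1.toBlocks₂₂ * S.1.toBlocks₂₁)
      (T.1.toBlocks₂₁ * S.1.toBlocks₁₂ + T.1.toBlocks₂₂ * S.1.toBlocks₂₂) := by
  rw [← Matrix.fromBlocks_multiply, Matrix.fromBlocks_toBlocks, Matrix.fromBlocks_toBlocks]
  rfl

/-- The stacked matrix (Q; P) is S(I; iI), so left multiplication by T acts on it by real blocks. -/
theorem Q_mul {d : ℕ} (T S : Sp d) :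
    Q (T * S) = T.1.toBlocks₁₁.map Complex.ofReal * Q S
      + T.1.toBlocks₁₂.map Complex.ofReal * P S := by
  simp only [Q, P, toBlocks_mul, Matrix.toBlocks_fromBlocks₁₁, Matrix.toBlocks_fromBlocks₁₂,
    Matrix.map_add _ Complex.ofReal_add, map_ofReal_mul, Matrix.mul_add, Matrix.mul_smul, smul_add]
  abel

theorem P_mul {d : ℕ} (T S : Sp d) :
    P (T * S) = T.1.toBlocks₂₁.map Complex.ofReal * Q S
      + T.1.toBlocks₂₂.map Complex.ofReal * P S := by
  simp only [Q, P, toBlocks_mul, Matrix.toBlocks_fromBlocks₂₁, Matrix.toBlocks_fromBlocks₂₂,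
    Matrix.map_add _ Complex.ofReal_add, map_ofReal_mul, Matrix.mul_add, Matrix.mul_smul, smul_add]
  abel

theorem map_ofReal_one {d : ℕ} :
    (1 : Matrix (Fin d) (Fin d) ℝ).map Complex.ofReal = 1 :=
  Matrix.map_one _ Complex.ofReal_zero Complex.ofReal_one

theorem Q_symJ_mul {d : ℕ} (S : Sp d) : Q (symJ d * S) = P S := by
  rw [Q_mul]; simp [symJ, Matrix.map_zero]

theorem P_symJ_mul {d : ℕ} (S : Sp d) : P (symJ d * S) = -Q S := by
  rw [P_mul]; simp [symJ, Matrix.map_zero, Matrix.map_neg]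

theorem Q_symV_mul {d : ℕ} {R : Matrix (Fin d) (Fin d) ℝ} (hR : R.IsSymm) (S : Sp d) :
    Q (symV R hR * S) = Q S := by
  rw [Q_mul]; simp [symV, Matrix.map_zero]

theorem P_symV_mul {d : ℕ} {R : Matrix (Fin d) (Fin d) ℝ} (hR : R.IsSymm) (S : Sp d) :
    P (symV R hR * S) = R.map Complex.ofReal * Q S + P S := by
  rw [P_mul]; simp [symV]

theorem Q_symM_mul {d : ℕ} (L : GL (Fin d) ℝ) (S : Sp d) :
    Q (symM L * S) = (L⁻¹ : GL (Fin d) ℝ).1.map Complex.ofReal * Q S := by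
  rw [Q_mul]; simp [symM, Matrix.map_zero]

theorem P_symM_mul {d : ℕ} (L : GL (Fin d) ℝ) (S : Sp d) :
    P (symM L * S) = (L.1.map Complex.ofReal)ᵀ * P S := by
  rw [P_mul]; simp [symM, Matrix.map_zero, Matrix.transpose_map]

/-! ### Symplectic relations and positivity of Im(P Q⁻¹) -/

theorem map_toBlocks_relations {d : ℕ} (S : Sp d) :
    let a := S.1.toBlocks₁₁.map Complex.ofReal
    let b := S.1.toBlocks₁₂.map Complex.ofReal
    let c := S.1.toBlocks₂₁.map Complex.ofReal
    let e := S.1.toBlocks₂₂.map Complex.ofReal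
    aᵀ * c = cᵀ * a ∧ bᵀ * e = eᵀ * b ∧ aᵀ * e - cᵀ * b = 1 ∧ eᵀ * a - bᵀ * c = 1 := by
  intro a b c e
  have hS := S.2
  rw [← Matrix.fromBlocks_toBlocks S.1, SymplecticGroup.fromBlocks_mem_iff] at hS
  obtain ⟨h1, h2, h3⟩ := hS
  have g3 : aᵀ * e - cᵀ * b = 1 := by
    have := congrArg (fun A => Matrix.map A Complex.ofReal) h3
    simpa only [Matrix.map_sub _ Complex.ofReal_sub, map_ofReal_mul, Matrix.transpose_map,
      map_ofReal_one] using this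
  refine ⟨?_, ?_, g3, ?_⟩
  · have := congrArg (fun A => Matrix.map A Complex.ofReal) h1
    simpa only [map_ofReal_mul, Matrix.transpose_map] using this
  · have := congrArg (fun A => Matrix.map A Complex.ofReal) h2
    simpa only [map_ofReal_mul, Matrix.transpose_map] using this
  · have := congrArg Matrix.transpose g3
    simpa only [Matrix.transpose_sub, Matrix.transpose_mul, Matrix.transpose_transpose,
      Matrix.transpose_one] using this

/-- The columns of (I; iI) span an isotropic subspace for the complexified symplectic form, and S
preserves the form. -/
theorem transpose_Q_mul_P {d : ℕ} (S : Sp d) : (Q S)ᵀ * P S = (P S)ᵀ * Q S := by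
  obtain ⟨h1, h2, h3, h4⟩ := map_toBlocks_relations S
  simp only [Q, P, Matrix.transpose_add, Matrix.transpose_smul, Matrix.mul_add, Matrix.add_mul,
    Matrix.mul_smul, Matrix.smul_mul]
  -- Matrix products do not commute, so they are kept as atoms and only the scalar coefficients are
  -- compared, by `module`.
  linear_combination (norm := skip) h1 + (Complex.I * Complex.I) • h2 + Complex.I • h3 - Complex.I • h4
  module

/-- Pairing the columns of (I; iI) with their conjugates gives -2i I; this nondegeneracy is the
source of positivity. -/
theorem transpose_Q_mul_conj_P {d : ℕ} (S : Sp d) :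
    (Q S)ᵀ * (P S).map (starRingEnd ℂ) - (P S)ᵀ * (Q S).map (starRingEnd ℂ)
      = (-(2 * Complex.I)) • (1 : Matrix (Fin d) (Fin d) ℂ) := by
  obtain ⟨h1, h2, h3, h4⟩ := map_toBlocks_relations S
  have hc : ∀ a b : Matrix (Fin d) (Fin d) ℝ,
      (a.map Complex.ofReal + Complex.I • b.map Complex.ofReal).map (starRingEnd ℂ)
        = a.map Complex.ofReal - Complex.I • b.map Complex.ofReal := by
    intro a b; ext i j; simp [sub_eq_add_neg]
  simp only [Q, P, hc, Matrix.transpose_add, Matrix.transpose_smul, Matrix.mul_sub, Matrix.add_mul,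
    Matrix.mul_smul, Matrix.smul_mul]
  linear_combination (norm := skip) h1 - (Complex.I * Complex.I) • h2 - Complex.I • h3 - Complex.I • h4
  module

theorem isUnit_det_Q {d : ℕ} (S : Sp d) : IsUnit (Q S).det :=
  isUnit_iff_ne_zero.mpr (det_Q_ne_zero S)

theorem isUnit_det_transpose_Q {d : ℕ} (S : Sp d) : IsUnit (Q S)ᵀ.det := by
  rw [Matrix.det_transpose]; exact isUnit_det_Q S

/-- P is the Q-block of the symplectic matrix J S. -/
theorem isUnit_det_P {d : ℕ} (S : Sp d) : IsUnit (P S).det := by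
  rw [← Q_symJ_mul]; exact isUnit_det_Q _

theorem isSymm_P_mul_Q_inv {d : ℕ} (S : Sp d) : (P S * (Q S)⁻¹).IsSymm := by
  rw [Matrix.IsSymm, Matrix.transpose_mul, Matrix.transpose_nonsing_inv]
  have h := congrArg (fun A => (Q S)ᵀ⁻¹ * A * (Q S)⁻¹) (transpose_Q_mul_P S)
  rw [Matrix.nonsing_inv_mul_cancel_left _ _ (isUnit_det_transpose_Q S), ← Matrix.mul_assoc,
    Matrix.mul_nonsing_inv_cancel_right _ _ (isUnit_det_Q S)] at h
  exact h.symm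

/-- The conjugate relation solved for P̄. It yields both the imaginary part of P Q⁻¹ and the change
of the `w`-quadratic term under Ĵ. -/
theorem conj_P_eq {d : ℕ} (S : Sp d) :
    (P S).map (starRingEnd ℂ) = P S * (Q S)⁻¹ * (Q S).map (starRingEnd ℂ)
      - (2 * Complex.I) • ((Q S)⁻¹)ᵀ := by
  have h := congrArg (fun A => (Q S)ᵀ⁻¹ * A) (transpose_Q_mul_conj_P S)
  simp only [Matrix.mul_sub, Matrix.mul_smul, Matrix.mul_one] at h
  rw [Matrix.nonsing_inv_mul_cancel_left _ _ (isUnit_det_transpose_Q S), ← Matrix.mul_assoc,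
    ← Matrix.transpose_nonsing_inv, ← Matrix.transpose_mul, (isSymm_P_mul_Q_inv S).eq] at h
  rw [eq_add_of_sub_eq h]
  module

/-- Multiplying `conj_P_eq` by Q̄⁻¹ on the right compares P Q⁻¹ with its conjugate; the difference
is 2i times a Gram matrix. -/
theorem map_im_P_mul_Q_inv {d : ℕ} (S : Sp d) :
    ((P S * (Q S)⁻¹).map Complex.im).map Complex.ofReal
      = ((Q S)⁻¹.map (starRingEnd ℂ))ᴴ * (Q S)⁻¹.map (starRingEnd ℂ) := by
  have hmul : ∀ A B : Matrix (Fin d) (Fin d) ℂ, (A * B).map (starRingEnd ℂ)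
      = A.map (starRingEnd ℂ) * B.map (starRingEnd ℂ) := fun A B => Matrix.map_mul
  have hB : (Q S).map (starRingEnd ℂ) * (Q S)⁻¹.map (starRingEnd ℂ) = 1 := by
    rw [← hmul, Matrix.mul_nonsing_inv _ (isUnit_det_Q S)]
    exact Matrix.map_one _ (map_zero _) (map_one _)
  have hBH : ((Q S)⁻¹.map (starRingEnd ℂ))ᴴ = ((Q S)⁻¹)ᵀ := by
    ext i j; simp
  have h := congrArg (fun A => A * (Q S)⁻¹.map (starRingEnd ℂ)) (conj_P_eq S)
  simp only [Matrix.sub_mul, Matrix.smul_mul] at h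
  rw [← hmul, Matrix.mul_assoc _ _ (Matrix.map _ _), hB, Matrix.mul_one] at h
  rw [hBH]
  ext i j
  have hij := congrFun (congrFun h i) j
  simp only [Matrix.map_apply, Matrix.sub_apply, Matrix.smul_apply, smul_eq_mul] at hij ⊢
  have h2 := Complex.sub_conj ((P S * (Q S)⁻¹) i j)
  rw [hij] at h2
  have h3 : (2 * Complex.I) ≠ 0 := mul_ne_zero two_ne_zero Complex.I_ne_zero
  apply mul_left_cancel₀ h3
  push_cast at h2
  linear_combination -h2

-- The Gram matrix of an invertible complex matrix is positive definite; testing it on real vectors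
-- gives the real statement.
open scoped ComplexOrder in
theorem posDef_im_P_mul_Q_inv {d : ℕ} (S : Sp d) : ((P S * (Q S)⁻¹).map Complex.im).PosDef := by
  set X := (P S * (Q S)⁻¹).map Complex.im with hX
  have hc : (X.map Complex.ofReal).PosDef := by
    rw [hX, map_im_P_mul_Q_inv]
    refine Matrix.PosDef.conjTranspose_mul_self _ (Matrix.mulVec_injective_iff_isUnit.mpr ?_)
    have hu : IsUnit (Q S)⁻¹ :=
      (Matrix.isUnit_nonsing_inv_iff).mpr ((Matrix.isUnit_iff_isUnit_det _).mpr (isUnit_det_Q S))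
    exact hu.map (starRingEnd ℂ).mapMatrix
  refine Matrix.PosDef.of_dotProduct_mulVec_pos ?_ fun x hx => ?_
  · ext i j
    simpa [hX] using congrArg Complex.im (congrFun (congrFun (isSymm_P_mul_Q_inv S) i) j)
  · have hx' : (fun i => (x i : ℂ)) ≠ 0 := fun h0 => hx <| by
      ext i; simpa using congrFun h0 i
    have := hc.dotProduct_mulVec_pos hx'
    have e : star (fun i => (x i : ℂ)) ⬝ᵥ ((X.map Complex.ofReal) *ᵥ fun i => (x i : ℂ))
        = ((star x ⬝ᵥ (X *ᵥ x) : ℝ) : ℂ) := by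
      simp [dotProduct, Matrix.mulVec]
    rw [e] at this
    exact_mod_cast this

/-! ### Γ as an integrable and square-integrable Gaussian -/

/-- The quadratic part of `Γ^ħ(S; w, ·)`, as a Gaussian. -/
noncomputable def gaussianMatrix {d : ℕ} (hbar : ℝ) (S : Sp d) : Matrix (Fin d) (Fin d) ℂ :=
  (-(Complex.I / hbar)) • (P S * (Q S)⁻¹)

/-- The linear part of `Γ^ħ(S; w, ·)`, as a Gaussian. -/
noncomputable def gaussianVector {d : ℕ} (hbar : ℝ) (S : Sp d) (w : Fin d → ℂ) : Fin d → ℂ :=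
  (2 / ((√hbar : ℝ) : ℂ)) • (((Q S)⁻¹)ᵀ *ᵥ w)

/-- The value `Γ^ħ(S; w, 0)`. -/
noncomputable def gaussianConst {d : ℕ} (hbar : ℝ) (S : Sp d) (μ : ℂ) (w : Fin d → ℂ) : ℂ :=
  μ / (((Real.pi * hbar) ^ ((d : ℝ) / 4) : ℝ) : ℂ) *
    Complex.exp (-(w ⬝ᵥ (((Q S)⁻¹ * (Q S).map (starRingEnd ℂ)) *ᵥ w)))

theorem Gamma_eq {d : ℕ} (hbar : ℝ) (S : Sp d) (μ : ℂ) (w : Fin d → ℂ) (x : Config d) :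
    Gamma hbar S μ w x = gaussianConst hbar S μ w *
      gaussian (gaussianMatrix hbar S) (gaussianVector hbar S w) x := by
  have h1 : w ⬝ᵥ ((Q S)⁻¹ *ᵥ cvec x) = (((Q S)⁻¹)ᵀ *ᵥ w) ⬝ᵥ cvec x := by
    rw [mulVec_dotProduct, Matrix.transpose_transpose]
  change _ * Complex.exp (_ * (cvec x ⬝ᵥ (_ *ᵥ cvec x)) + _ * (w ⬝ᵥ ((Q S)⁻¹ *ᵥ cvec x)) - _) = _
  rw [gaussian, gaussianConst, gaussianMatrix, gaussianVector, mul_assoc, ← Complex.exp_add, h1,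
    smul_dotProduct, Matrix.smul_mulVec, dotProduct_smul, smul_eq_mul, smul_eq_mul]
  congr 2
  ring

theorem isSymm_gaussianMatrix {d : ℕ} (hbar : ℝ) (S : Sp d) :
    (gaussianMatrix hbar S).IsSymm := by
  rw [gaussianMatrix, Matrix.IsSymm, Matrix.transpose_smul, (isSymm_P_mul_Q_inv S).eq]

theorem posDef_re_gaussianMatrix {d : ℕ} {hbar : ℝ} (h : 0 < hbar) (S : Sp d) :
    ((gaussianMatrix hbar S).map Complex.re).PosDef := by
  have e : (gaussianMatrix hbar S).map Complex.re
      = hbar⁻¹ • (P S * (Q S)⁻¹).map Complex.im := by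
    ext i j
    have : -(Complex.I / (hbar : ℂ)) = ((hbar⁻¹ : ℝ) : ℂ) * -Complex.I := by
      push_cast; ring
    simp only [gaussianMatrix, Matrix.map_apply, Matrix.smul_apply, smul_eq_mul, this, mul_assoc,
      Complex.re_ofReal_mul]
    simp
  rw [e]
  exact (posDef_im_P_mul_Q_inv S).smul (inv_pos.mpr h)

theorem integrable_Gamma {d : ℕ} {hbar : ℝ} (h : 0 < hbar) (S : Sp d) (μ : ℂ) (w : Fin d → ℂ) :
    Integrable (Gamma hbar S μ w) := by
  obtain ⟨c, -, hc⟩ := exists_integral_gaussian (isSymm_gaussianMatrix hbar S)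
    (posDef_re_gaussianMatrix h S)
  refine ((hc (gaussianVector hbar S w)).1.const_mul (gaussianConst hbar S μ w)).congr
    (Filter.Eventually.of_forall fun x => (Gamma_eq hbar S μ w x).symm)

/-- The squared modulus is the modulus of the Gaussian with data 2M and 2b, which is integrable. -/
theorem memLp_gaussian {d : ℕ} {M : Matrix (Fin d) (Fin d) ℂ} (hM : M.IsSymm)
    (hre : (M.map Complex.re).PosDef) (b : Fin d → ℂ) : MemLp (gaussian M b) 2 := by
  rw [memLp_two_iff_integrable_sq_norm (continuous_gaussian M b).aestronglyMeasurable]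
  have hM2 : ((2 : ℝ) • M).IsSymm := by rw [Matrix.IsSymm, Matrix.transpose_smul, hM.eq]
  have hre2 : (((2 : ℝ) • M).map Complex.re).PosDef := by
    have : ((2 : ℝ) • M).map Complex.re = (2 : ℝ) • M.map Complex.re := by
      ext i j; simp
    rw [this]
    exact hre.smul two_pos
  obtain ⟨c, -, hc⟩ := exists_integral_gaussian hM2 hre2
  refine (hc ((2 : ℝ) • b)).1.norm.congr (Filter.Eventually.of_forall fun x => ?_)
  simp only
  rw [← norm_pow]
  congr 1
  rw [gaussian, gaussian, ← Complex.exp_nat_mul, Matrix.smul_mulVec, dotProduct_smul,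
    smul_dotProduct, Complex.real_smul, Complex.real_smul]
  congr 1
  push_cast
  ring

theorem memLp_Gamma {d : ℕ} {hbar : ℝ} (h : 0 < hbar) (S : Sp d) (μ : ℂ) (w : Fin d → ℂ) :
    MemLp (Gamma hbar S μ w) 2 (volume : Measure (Config d)) := by
  rw [funext (Gamma_eq hbar S μ w)]
  exact (memLp_gaussian (isSymm_gaussianMatrix hbar S) (posDef_re_gaussianMatrix h S) _).const_mul _

/-- `Γ^ħ(S; w, ·)` as an element of `L²(ℝᵈ)`. -/
noncomputable def GammaL2 {d : ℕ} {hbar : ℝ} (h : 0 < hbar) (S : Sp d) (μ : ℂ) (w : Fin d → ℂ) :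
    L2 d :=
  (memLp_Gamma h S μ w).toLp _

theorem GammaL2_coeFn {d : ℕ} {hbar : ℝ} (h : 0 < hbar) (S : Sp d) (μ : ℂ) (w : Fin d → ℂ) :
    (GammaL2 h S μ w : Config d → ℂ) =ᵐ[volume] Gamma hbar S μ w :=
  MemLp.coeFn_toLp _

/-! ### Covariance under products and inverses -/

/-- The unitary operator `U` maps `Γ^ħ(S₀; w, ·)` to `Γ^ħ(S S₀; w, ·)`. -/
def IsCovariant {d : ℕ} {hbar : ℝ} (h : 0 < hbar) (U : UnitaryOps d) (S : Sp d) : Prop :=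
  ∀ (S₀ : Sp d) (μ₀ : ℂ), IsMu S₀ μ₀ → ∃ μ : ℂ, IsMu (S * S₀) μ ∧
    ∀ w : Fin d → ℂ, U (GammaL2 h S₀ μ₀ w) = GammaL2 h (S * S₀) μ w

theorem GammaL2_neg {d : ℕ} {hbar : ℝ} (h : 0 < hbar) (S : Sp d) (μ : ℂ) (w : Fin d → ℂ) :
    GammaL2 h S (-μ) w = -GammaL2 h S μ w := by
  refine Lp.ext ?_
  filter_upwards [GammaL2_coeFn h S (-μ) w, GammaL2_coeFn h S μ w,
    Lp.coeFn_neg (GammaL2 h S μ w)] with x h1 h2 h3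
  rw [h1, h3, Pi.neg_apply, h2]
  simp only [Gamma]
  ring

theorem IsMu.neg {d : ℕ} {S : Sp d} {μ : ℂ} (hμ : IsMu S μ) : IsMu S (-μ) := by
  rwa [IsMu, neg_sq]

theorem IsMu.eq_or_eq_neg {d : ℕ} {S : Sp d} {μ ν : ℂ} (hμ : IsMu S μ) (hν : IsMu S ν) :
    μ = ν ∨ μ = -ν :=
  sq_eq_sq_iff_eq_or_eq_neg.mp (mul_right_cancel₀ (det_Q_ne_zero S) (Eq.trans hμ hν.symm))

theorem isCovariant_one {d : ℕ} {hbar : ℝ} (h : 0 < hbar) :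
    IsCovariant h (1 : UnitaryOps d) 1 := fun S₀ μ₀ hμ₀ =>
  ⟨μ₀, by rwa [one_mul], fun w => by rw [one_mul]; rfl⟩

theorem IsCovariant.mul {d : ℕ} {hbar : ℝ} {h : 0 < hbar} {U V : UnitaryOps d} {S T : Sp d}
    (hU : IsCovariant h U S) (hV : IsCovariant h V T) : IsCovariant h (U * V) (S * T) := by
  intro S₀ μ₀ hμ₀
  obtain ⟨μ₁, hμ₁, h1⟩ := hV S₀ μ₀ hμ₀
  obtain ⟨μ₂, hμ₂, h2⟩ := hU _ μ₁ hμ₁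
  rw [mul_assoc]
  exact ⟨μ₂, hμ₂, fun w => (congrArg U (h1 w)).trans (h2 w)⟩

/-- Apply covariance of U at S⁻¹S₀ with any root. The resulting root at S₀ is the prescribed one up
to sign, and the sign is absorbed by negating the root chosen at S⁻¹S₀. -/
theorem IsCovariant.inv {d : ℕ} {hbar : ℝ} {h : 0 < hbar} {U : UnitaryOps d} {S : Sp d}
    (hU : IsCovariant h U S) : IsCovariant h U⁻¹ S⁻¹ := by
  intro S₀ μ₀ hμ₀
  obtain ⟨μ₁, hμ₁⟩ := exists_isMu (S⁻¹ * S₀)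
  obtain ⟨μ₂, hμ₂, h2⟩ := hU _ μ₁ hμ₁
  rw [mul_inv_cancel_left] at hμ₂ h2
  have hinv : ∀ f g : L2 d, U f = g → U⁻¹ g = f := by
    rintro f _ rfl
    exact U.symm_apply_apply f
  rcases hμ₀.eq_or_eq_neg hμ₂ with rfl | rfl
  · exact ⟨μ₁, hμ₁, fun w => hinv _ _ (h2 w)⟩
  · refine ⟨-μ₁, hμ₁.neg, fun w => hinv _ _ ?_⟩
    rw [GammaL2_neg, GammaL2_neg, map_neg, h2]

/-! ### The generators V̂_R and M̂_L -/

theorem quadForm_ofReal {d : ℕ} (R : Matrix (Fin d) (Fin d) ℝ) (x : Config d) :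
    ((quadForm R x : ℝ) : ℂ) = cvec x ⬝ᵥ (R.map Complex.ofReal *ᵥ cvec x) := by
  simp [quadForm, cvec, dotProduct, Matrix.mulVec]

/-- Q is unchanged and P Q⁻¹ becomes R + P Q⁻¹, so the same root serves. -/
theorem isCovariant_VHat {d : ℕ} {hbar : ℝ} (h : 0 < hbar) {R : Matrix (Fin d) (Fin d) ℝ}
    (hR : R.IsSymm) : IsCovariant h (VHat d hbar R) (symV R hR) := by
  intro S μ hμ
  refine ⟨μ, by rwa [IsMu, Q_symV_mul], fun w => Lp.ext ?_⟩
  filter_upwards [VHat_coeFn d hbar R (GammaL2 h S μ w), GammaL2_coeFn h S μ w,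
    GammaL2_coeFn h (symV R hR * S) μ w] with x h1 h2 h3
  have hb : (hbar : ℂ) ≠ 0 := by exact_mod_cast h.ne'
  rw [h1, h2, h3, Gamma, Gamma, Q_symV_mul, P_symV_mul, Matrix.add_mul,
    Matrix.mul_nonsing_inv_cancel_right _ _ (isUnit_det_Q S), Matrix.add_mulVec, dotProduct_add,
    mul_left_comm, ← Complex.exp_add, Complex.ofReal_div, quadForm_ofReal]
  congr 2
  change _ + (_ * (cvec x ⬝ᵥ (_ *ᵥ cvec x)) + _ - _)
    = _ * (cvec x ⬝ᵥ (_ *ᵥ cvec x) + cvec x ⬝ᵥ (_ *ᵥ cvec x)) + _ - _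
  push_cast
  field_simp
  ring

theorem cvec_glEquiv {d : ℕ} (L : GL (Fin d) ℝ) (x : Config d) :
    cvec (glEquiv L x) = L.1.map Complex.ofReal *ᵥ cvec x := by
  ext i
  simp [glEquiv_apply, cvec, dotProduct, Matrix.mulVec]

/-- i²ᵐ = exp(iπm) = exp(i arg det L) by admissibility of m, which restores the sign missing from
|det L|. -/
theorem IsIndex.I_zpow_sq {d : ℕ} {L : GL (Fin d) ℝ} {m : ℤ} (hm : IsIndex L m) :
    (Complex.I ^ m * ((√|L.1.det| : ℝ) : ℂ)) ^ 2 = (L.1.det : ℂ) := by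
  obtain ⟨k, hk⟩ := hm
  have e1 : ((√|L.1.det| : ℝ) : ℂ) ^ 2 = ((|L.1.det| : ℝ) : ℂ) := by
    exact_mod_cast Real.sq_sqrt (abs_nonneg L.1.det)
  have e2 : (Complex.I ^ m) ^ 2 = Complex.exp (Complex.arg (L.1.det : ℂ) * Complex.I) := by
    have : Complex.I = Complex.exp (Real.pi / 2 * Complex.I) := Complex.exp_pi_div_two_mul_I.symm
    conv_lhs => rw [this]
    rw [← Complex.exp_int_mul, ← Complex.exp_nat_mul, Complex.exp_eq_exp_iff_exists_int]
    refine ⟨k, ?_⟩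
    have hk' := congrArg (fun r : ℝ => (r : ℂ)) hk
    push_cast at hk' ⊢
    linear_combination Complex.I * hk'
  rw [mul_pow, e1, e2]
  have := Complex.norm_mul_exp_arg_mul_I (L.1.det : ℂ)
  rw [Complex.norm_real, Real.norm_eq_abs] at this
  rw [mul_comm, this]

/-- Q becomes L⁻¹Q and P becomes LᵀP. Hence Q⁻¹Q̄ is invariant because L is real, and 1/det Q gains
the factor det L. -/
theorem isCovariant_MHat {d : ℕ} {hbar : ℝ} (h : 0 < hbar) {L : GL (Fin d) ℝ} {m : ℤ}
    (hm : IsIndex L m) : IsCovariant h (MHat d L m) (symM L) := by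
  intro S μ hμ
  set Lc := L.1.map Complex.ofReal with hLc
  set Lc' := (L⁻¹ : GL (Fin d) ℝ).1.map Complex.ofReal with hLc'
  have hLL : Lc' * Lc = 1 := by
    rw [hLc, hLc', ← map_ofReal_mul, L.inv_mul, map_ofReal_one]
  have hdet : Lc.det = (L.1.det : ℂ) := (RingHom.map_det Complex.ofRealHom L.1).symm
  have hdet1 : Lc'.det * Lc.det = 1 := by rw [← Matrix.det_mul, hLL, Matrix.det_one]
  have hinv : (Q (symM L * S))⁻¹ = (Q S)⁻¹ * Lc := by
    rw [Q_symM_mul, Matrix.mul_inv_rev, Matrix.inv_eq_right_inv hLL]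
  have hconj : (Q (symM L * S)).map (starRingEnd ℂ) = Lc' * (Q S).map (starRingEnd ℂ) := by
    have e : Lc'.map (starRingEnd ℂ) = Lc' := by ext i j; simp [hLc']
    rw [Q_symM_mul, Matrix.map_mul, e]
  refine ⟨Complex.I ^ m * ((√|L.1.det| : ℝ) : ℂ) * μ, ?_, fun w => Lp.ext ?_⟩
  · rw [IsMu, mul_pow, hm.I_zpow_sq, Q_symM_mul, Matrix.det_mul, ← hdet]
    have hμ' : μ ^ 2 * (Q S).det = 1 := hμ
    linear_combination (μ ^ 2 * (Q S).det) * hdet1 + hμ'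
  · filter_upwards [weightedSubst_coeFn _ _ _ _ (GammaL2 h S μ w),
      WeightedSubst.ae_comp (glEquiv L) (GammaL2_coeFn h S μ w),
      GammaL2_coeFn h (symM L * S) (Complex.I ^ m * ((√|L.1.det| : ℝ) : ℂ) * μ) w] with x h1 h2 h3
    refine h1.trans ?_
    rw [h2, h3, Gamma, Gamma, hinv, P_symM_mul, hconj]
    change _ * (_ * Complex.exp (_ * (cvec _ ⬝ᵥ (_ *ᵥ cvec _)) + _ * (w ⬝ᵥ (_ *ᵥ cvec _)) - _))
      = _ * Complex.exp (_ * (cvec x ⬝ᵥ (_ *ᵥ cvec x)) + _ * (w ⬝ᵥ (_ *ᵥ cvec x)) - _)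
    have hcancel : (Q S)⁻¹ * Lc * (Lc' * (Q S).map (starRingEnd ℂ))
        = (Q S)⁻¹ * (Q S).map (starRingEnd ℂ) := by
      rw [Matrix.mul_assoc, ← Matrix.mul_assoc Lc, mul_eq_one_comm.mp hLL, Matrix.one_mul]
    have hquad : Lcᵀ * (P S * (Q S)⁻¹) * Lc = Lcᵀ * P S * ((Q S)⁻¹ * Lc) := by
      simp only [Matrix.mul_assoc]
    rw [cvec_glEquiv, ← hLc, mulVec_dotProduct, Matrix.mulVec_mulVec, Matrix.mulVec_mulVec,
      Matrix.mulVec_mulVec, hcancel, hquad]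
    ring

/-! ### The generator Ĵ -/

theorem gaussianMatrix_inv {d : ℕ} {hbar : ℝ} (h : 0 < hbar) (S : Sp d) :
    (gaussianMatrix hbar S)⁻¹ = (Complex.I * hbar) • (Q S * (P S)⁻¹) := by
  have hb : (hbar : ℂ) ≠ 0 := by exact_mod_cast h.ne'
  apply Matrix.inv_eq_right_inv
  rw [gaussianMatrix, Matrix.smul_mul, Matrix.mul_smul, smul_smul, Matrix.mul_assoc,
    Matrix.nonsing_inv_mul_cancel_left _ _ (isUnit_det_Q S),
    Matrix.mul_nonsing_inv _ (isUnit_det_P S)]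
  have : -(Complex.I / (hbar : ℂ)) * (Complex.I * hbar) = 1 := by
    field_simp
    simp
  rw [this, one_smul]

/-- This is the symmetry of P Q⁻¹ read at J S, whose pair is (P; -Q). -/
theorem isSymm_Q_mul_P_inv {d : ℕ} (S : Sp d) : (Q S * (P S)⁻¹).IsSymm := by
  have := isSymm_P_mul_Q_inv (symJ d * S)
  rw [Q_symJ_mul, P_symJ_mul, Matrix.neg_mul] at this
  have h2 : -(Q S * (P S)⁻¹)ᵀ = -(Q S * (P S)⁻¹) := by simpa [Matrix.IsSymm] using this
  exact neg_injective h2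

theorem P_inv_mul_conj_P {d : ℕ} (S : Sp d) :
    (P S)⁻¹ * (P S).map (starRingEnd ℂ) = (Q S)⁻¹ * (Q S).map (starRingEnd ℂ)
      - (2 * Complex.I) • ((P S)⁻¹ * ((Q S)⁻¹)ᵀ) := by
  rw [conj_P_eq, Matrix.mul_sub, Matrix.mul_assoc (P S),
    Matrix.nonsing_inv_mul_cancel_left _ _ (isUnit_det_P S), Matrix.mul_smul]

/-- The exponent of the Fourier transform of `Γ^ħ(S; w, ·)` is that of `Γ^ħ(J S; w, ·)`. -/
theorem gaussianVector_sub_exponent {d : ℕ} {hbar : ℝ} (h : 0 < hbar) (S : Sp d)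
    (w u : Fin d → ℂ) :
    1 / 2 * ((gaussianVector hbar S w - (Complex.I / hbar) • u) ⬝ᵥ
        ((gaussianMatrix hbar S)⁻¹ *ᵥ (gaussianVector hbar S w - (Complex.I / hbar) • u)))
      - w ⬝ᵥ (((Q S)⁻¹ * (Q S).map (starRingEnd ℂ)) *ᵥ w)
    = Complex.I / (2 * (hbar : ℂ)) * (u ⬝ᵥ ((-Q S * (P S)⁻¹) *ᵥ u))
      + 2 / ((√hbar : ℝ) : ℂ) * (w ⬝ᵥ ((P S)⁻¹ *ᵥ u))
      - w ⬝ᵥ (((P S)⁻¹ * (P S).map (starRingEnd ℂ)) *ᵥ w) := by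
  have hb : (hbar : ℂ) ≠ 0 := by exact_mod_cast h.ne'
  have hs0 : ((√hbar : ℝ) : ℂ) ≠ 0 := by exact_mod_cast (Real.sqrt_pos.mpr h).ne'
  have hs : ((√hbar : ℝ) : ℂ) ^ 2 = hbar := by exact_mod_cast Real.sq_sqrt h.le
  set N := Q S * (P S)⁻¹ with hN
  set v := ((Q S)⁻¹)ᵀ *ᵥ w with hv
  have hvN : ∀ z, v ⬝ᵥ (N *ᵥ z) = w ⬝ᵥ ((P S)⁻¹ *ᵥ z) := by
    intro z
    rw [hv, mulVec_dotProduct, Matrix.transpose_transpose, Matrix.mulVec_mulVec, hN,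
      Matrix.nonsing_inv_mul_cancel_left _ _ (isUnit_det_Q S)]
  have huv : u ⬝ᵥ (N *ᵥ v) = v ⬝ᵥ (N *ᵥ u) := by
    rw [dotProduct_comm, mulVec_dotProduct, (isSymm_Q_mul_P_inv S).eq]
  rw [gaussianMatrix_inv h, P_inv_mul_conj_P, gaussianVector, ← hv, ← hN, Matrix.neg_mul, ← hN,
    Matrix.smul_mulVec, Matrix.mulVec_sub, Matrix.mulVec_smul, Matrix.mulVec_smul,
    Matrix.sub_mulVec, Matrix.smul_mulVec, ← Matrix.mulVec_mulVec (v := w) (M := (P S)⁻¹), ← hv]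
  simp only [dotProduct_smul, smul_dotProduct, dotProduct_sub, sub_dotProduct, smul_eq_mul,
    Matrix.neg_mulVec, dotProduct_neg, huv, hvN]
  -- With ħ written as (√ħ)², both sides are rational in √ħ.
  rw [← hs]
  field_simp
  ring_nf
  simp only [Complex.I_sq, show Complex.I ^ 3 = -Complex.I by rw [pow_succ, Complex.I_sq]; ring]
  ring

theorem rescale_coeFn (d : ℕ) (hbar : ℝ) (h : 0 < hbar) (ψ : L2 d) :
    (rescale d hbar h ψ : Config d → ℂ) =ᵐ[volume] fun x =>
      Complex.exp (((-(Real.pi * d / 4) : ℝ) : ℂ) * Complex.I)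
        * (((2 * Real.pi * hbar) ^ (-(d : ℝ) / 2) : ℝ) : ℂ) * ψ ((2 * Real.pi * hbar)⁻¹ • x) :=
  weightedSubst_coeFn _ _ _ _ ψ

theorem rescale_const_sq (d : ℕ) {hbar : ℝ} (h : 0 < hbar) :
    (Complex.exp (((-(Real.pi * d / 4) : ℝ) : ℂ) * Complex.I)
        * (((2 * Real.pi * hbar) ^ (-(d : ℝ) / 2) : ℝ) : ℂ)) ^ 2
      = (-Complex.I / (2 * Real.pi * hbar)) ^ d := by
  have hp : 0 < 2 * Real.pi * hbar := by positivity
  have e1 : Complex.exp (((-(Real.pi * d / 4) : ℝ) : ℂ) * Complex.I) ^ 2 = (-Complex.I) ^ d := by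
    rw [← Complex.exp_neg_pi_div_two_mul_I, ← Complex.exp_nat_mul, ← Complex.exp_nat_mul]
    congr 1
    push_cast
    ring
  have e2 : ((2 * Real.pi * hbar) ^ (-(d : ℝ) / 2)) ^ 2 = ((2 * Real.pi * hbar) ^ d)⁻¹ := by
    rw [← Real.rpow_natCast, ← Real.rpow_mul hp.le, ← Real.rpow_natCast, ← Real.rpow_neg hp.le]
    congr 1
    push_cast
    ring
  rw [mul_pow, e1, ← Complex.ofReal_pow, e2, div_pow, div_eq_mul_inv]
  push_cast
  rfl

theorem memLp_comp_smul {d : ℕ} {f : Config d → ℂ} (hf : Continuous f) (hf2 : MemLp f 2)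
    {R : ℝ} (hR : R ≠ 0) : MemLp (fun x => f (R • x)) 2 := by
  have hm : AEStronglyMeasurable (fun x : Config d => f (R • x)) volume :=
    Continuous.aestronglyMeasurable (by fun_prop)
  rw [memLp_two_iff_integrable_sq_norm hm]
  rw [memLp_two_iff_integrable_sq_norm hf.aestronglyMeasurable] at hf2
  exact hf2.comp_smul hR

theorem continuous_Gamma {d : ℕ} (hbar : ℝ) (S : Sp d) (μ : ℂ) (w : Fin d → ℂ) :
    Continuous (Gamma hbar S μ w) := by
  rw [funext (Gamma_eq hbar S μ w)]
  exact continuous_const.mul (continuous_gaussian _ _)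

/-- The Fourier character shifts the linear part of the Gaussian by -(i/ħ)u, where u = 2πħξ. The
constant `c` depends on neither `w` nor ξ, so it can be moved into the root. -/
theorem fourier_Gamma {d : ℕ} {hbar : ℝ} (h : 0 < hbar) (S : Sp d) {c : ℂ}
    (hc : ∀ b : Fin d → ℂ, ∫ x, gaussian (gaussianMatrix hbar S) b x
      = c * Complex.exp (1 / 2 * (b ⬝ᵥ ((gaussianMatrix hbar S)⁻¹ *ᵥ b))))
    (μ : ℂ) (w : Fin d → ℂ) (ξ : Config d) :
    (FourierTransform.fourier (Gamma hbar S μ w) : Config d → ℂ) ξ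
      = Gamma hbar (symJ d * S) (c * μ) w ((2 * Real.pi * hbar) • ξ) := by
  have hb : (hbar : ℂ) ≠ 0 := by exact_mod_cast h.ne'
  set u := cvec ((2 * Real.pi * hbar) • ξ) with hu
  have hint : ∀ y : Config d, Complex.exp (((-2 * Real.pi * inner ℝ y ξ : ℝ) : ℂ) * Complex.I)
      • Gamma hbar S μ w y = gaussianConst hbar S μ w * gaussian (gaussianMatrix hbar S)
        (gaussianVector hbar S w - (Complex.I / hbar) • u) y := by
    intro y
    have hin : ((inner ℝ y ξ : ℝ) : ℂ) = cvec ξ ⬝ᵥ cvec y := by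
      simp [PiLp.inner_apply, cvec, dotProduct]
    have hus : u = ((2 * Real.pi * hbar : ℝ) : ℂ) • cvec ξ := by
      ext i; simp [hu, cvec]
    rw [Gamma_eq, smul_eq_mul, mul_left_comm, gaussian, gaussian, ← Complex.exp_add,
      sub_dotProduct, hus, smul_dotProduct, smul_dotProduct, ← hin, smul_eq_mul, smul_eq_mul]
    congr 2
    push_cast
    field_simp
    ring
  rw [Real.fourier_eq']
  simp only [hint]
  rw [integral_const_mul, hc, Gamma, Q_symJ_mul, P_symJ_mul]
  change _ = _ * Complex.exp (_ * (u ⬝ᵥ (_ *ᵥ u)) + _ * (w ⬝ᵥ (_ *ᵥ u)) - _)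
  rw [← gaussianVector_sub_exponent h, gaussianConst,
    sub_eq_add_neg (1 / 2 * _), Complex.exp_add]
  ring

/-- The dilation in Ĵ undoes the factor 2πħ in `fourier_Gamma`, leaving only the check that the
total prefactor is an admissible root. -/
theorem isCovariant_JHat (d : ℕ) {hbar : ℝ} (h : 0 < hbar) :
    IsCovariant h (JHat d hbar h) (symJ d) := by
  intro S μ hμ
  have hp : 0 < 2 * Real.pi * hbar := by positivity
  have hb : (hbar : ℂ) ≠ 0 := by exact_mod_cast h.ne'
  have hpi : (Real.pi : ℂ) ≠ 0 := by exact_mod_cast Real.pi_ne_zero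
  obtain ⟨c, hc2, hc⟩ := exists_integral_gaussian (isSymm_gaussianMatrix hbar S)
    (posDef_re_gaussianMatrix h S)
  set r := Complex.exp (((-(Real.pi * d / 4) : ℝ) : ℂ) * Complex.I)
        * (((2 * Real.pi * hbar) ^ (-(d : ℝ) / 2) : ℝ) : ℂ) with hr
  have hfour := fourier_Gamma h S (fun b => (hc b).2) μ
  refine ⟨r * (c * μ), ?_, fun w => Lp.ext ?_⟩
  · have hdet : (gaussianMatrix hbar S).det * (Q S).det
        = (-(Complex.I / hbar)) ^ d * (P S).det := by
      rw [gaussianMatrix, Matrix.det_smul, Fintype.card_fin, Matrix.det_mul, mul_assoc,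
        mul_assoc, ← Matrix.det_mul (Q S)⁻¹, Matrix.nonsing_inv_mul _ (isUnit_det_Q S), Matrix.det_one,
        mul_one]
    have hμ' : μ ^ 2 * (Q S).det = 1 := hμ
    have hk : (-Complex.I / (2 * Real.pi * hbar)) ^ d * (2 * Real.pi) ^ d
        = (-(Complex.I / hbar)) ^ d := by
      rw [← mul_pow]
      congr 1
      field_simp
    have hk0 : (-(Complex.I / (hbar : ℂ))) ^ d ≠ 0 :=
      pow_ne_zero _ (neg_ne_zero.mpr (div_ne_zero Complex.I_ne_zero hb))
    rw [IsMu, Q_symJ_mul, mul_pow, hr, rescale_const_sq d h]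
    -- The factor (-i/ħ)ᵈ turns det P into det M · det Q. Then c² det M = (2π)ᵈ and μ² det Q = 1
    -- finish the count.
    apply mul_left_cancel₀ hk0
    set s := (-Complex.I / (2 * Real.pi * hbar)) ^ d
    calc _ = s * c ^ 2 * μ ^ 2 * ((-(Complex.I / hbar)) ^ d * (P S).det) := by ring
      _ = s * (c ^ 2 * (gaussianMatrix hbar S).det) * (μ ^ 2 * (Q S).det) := by
        rw [← hdet]; ring
      _ = _ := by rw [hc2, hμ', hk]
  · have hmem : MemLp (FourierTransform.fourier (Gamma hbar S μ w) : Config d → ℂ) 2 := by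
      rw [funext (hfour w)]
      exact memLp_comp_smul (continuous_Gamma _ _ _ _) (memLp_Gamma h _ _ _) hp.ne'
    have hJ : JHat d hbar h (GammaL2 h S μ w) = rescale d hbar h (hmem.toLp _) :=
      congrArg (rescale d hbar h)
        (fourierTransform_toLp (integrable_Gamma h S μ w) (memLp_Gamma h S μ w) hmem)
    rw [hJ]
    have hsub := WeightedSubst.ae_comp (ContinuousLinearEquiv.smulLeft
      (Units.mk0 ((2 * Real.pi * hbar)⁻¹) (inv_ne_zero hp.ne'))) hmem.coeFn_toLp
    filter_upwards [rescale_coeFn d hbar h (hmem.toLp _), hsub,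
      GammaL2_coeFn h (symJ d * S) (r * (c * μ)) w] with x h1 h2 h3
    have h2' : (hmem.toLp _ : Config d → ℂ) ((2 * Real.pi * hbar)⁻¹ • x)
      = (FourierTransform.fourier (Gamma hbar S μ w) : Config d → ℂ)
          ((2 * Real.pi * hbar)⁻¹ • x) := h2
    rw [h1, h3, h2', hfour, smul_inv_smul₀ hp.ne', Gamma, Gamma]
    ring

/-! ### From the generators to the whole group -/

/-- Induction over the subgroup of pairs carries operator and symplectic matrix together, so
well-definedness of the projection is never needed. -/
theorem IsMetaplecticOver.isCovariant {d : ℕ} {hbar : ℝ} {h : 0 < hbar} {U : UnitaryOps d}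
    {S : Sp d} (hS : IsMetaplecticOver h U S) : IsCovariant h U S := by
  have key : ∀ q ∈ projectionGraph d hbar h, IsCovariant h q.1 q.2 := by
    intro q hq
    rw [projectionGraph] at hq
    induction hq using Subgroup.closure_induction with
    | mem q hq =>
      rcases hq with (hq | ⟨R, hR, hq⟩) | ⟨L, m, hm, hq⟩
      · rw [Set.mem_singleton_iff.mp hq]
        exact isCovariant_JHat d h
      · rw [hq]
        exact isCovariant_VHat h hR
      · rw [hq]
        exact isCovariant_MHat h hm
    | one => exact isCovariant_one h
    | mul p q _ _ hp hq => exact hp.mul hq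
    | inv p _ hp => exact hp.inv
  exact key (U, S) hS

end Metaplectic

theorem mainTheorem10 (d : ℕ) (hbar : ℝ) (h : 0 < hbar)
    (Shat : UnitaryOps d) (S S₀ : Sp d) (hS : IsMetaplecticOver h Shat S)
    (μ₀ : ℂ) (hμ₀ : IsMu S₀ μ₀) :
    ∃ μ : ℂ, IsMu (S * S₀) μ ∧
      ∀ w : Fin d → ℂ, ∃ hΓ : MemLp (Gamma hbar S₀ μ₀ w) 2 (volume : Measure (Config d)),
        (Shat (hΓ.toLp (Gamma hbar S₀ μ₀ w)) : Config d → ℂ)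
          =ᵐ[volume] Gamma hbar (S * S₀) μ w := by
  obtain ⟨μ, hμ, hw⟩ := hS.isCovariant S₀ μ₀ hμ₀
  refine ⟨μ, hμ, fun w => ⟨memLp_Gamma h S₀ μ₀ w, ?_⟩⟩
  have := GammaL2_coeFn h (S * S₀) μ w
  rwa [← hw w] at this
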